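/- Let $X$ and $Y$ be complex Banach spaces, let $A:D(A)\subseteq X\to X$ be the generator of an analytic semigroup $(T(z))_{z\in\Sigma_\delta\cup\{0\}}$ on $X$ of some angle $\delta\in(0,\frac{\pi}{2}]$, where $\Sigma_\delta=\{z\in\mathbb C\setminus\{0\}:|\arg z|<\delta\}$, and let $K:D(K)\subseteq X\to Y$ be a closed linear operator with $D(A)\subseteq D(K)$. Denote by $$\omega(A)=\inf\{w\in\mathbb R:\ \text{there is } M'\ge 0 \text{ with } \|T(t)\|\le M'e^{wt}\text{ for all }t\ge0\}\in[-\infty,\infty)$$ the growth bound of the semigroup. Suppose that there are $\alpha\in(0,1)$, $M\ge0$ and $\rho_0>0$ such that for every $\rho\ge\rho_0$ $$\|Kx\|\le M\bigl(\rho^{\alpha}\|x\|+\rho^{\alpha-1}\|Ax\|\bigr)\qquad\text{for all }x\in D(A).$$ Then for every real $\gamma>\alpha$ and every real $\lambda>\omega(A)$ one has $[D((\lambda-A)^\gamma)]\hookrightarrow[D(K)]$, that is, $D((\lambda-A)^\gamma)\subseteq D(K)$ and there is a constant $C$ with $$\|x\|+\|Kx\|\le C\bigl(\|x\|+\|(\lambda-A)^\gamma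 x\|\bigr)\qquad\text{for all }x\in D((\lambda-A)^\gamma).$$ Here $[D(L)]$ denotes the domain of a linear operator $L$ with the graph norm $\|x\|+\|Lx\|$, and for $\gamma>0$ the fractional power $(\lambda-A)^\gamma$ is the inverse, defined on the range, of the injective bounded operator $$(\lambda-A)^{-\gamma}=\frac1{\Gamma(\gamma)}\int_0^\infty t^{\gamma-1}e^{-\lambda t}\,T(t)\,dt .$$ -/

import Mathlib

open MeasureTheory Filter Topology Set

noncomputable section

namespace AnalyticSG

/-- The open sector `{z ≠ 0 : |arg z| < δ}` in the complex plane. -/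
def sector (δ : ℝ) : Set ℂ := {z | z ≠ 0 ∧ |Complex.arg z| < δ}

/-- `(T z)`, for `z` in the sector of angle `δ` or `z = 0`, is an analytic semigroup of angle
`δ ∈ (0, π/2]` (boundedness on the sector is not required). The values of `T` elsewhere
are irrelevant. -/
structure IsAnalyticSemigroup {X : Type*} [NormedAddCommGroup X] [NormedSpace ℂ X]
    (δ : ℝ) (T : ℂ → X →L[ℂ] X) : Prop where
  angle_pos : 0 < δ
  angle_le : δ ≤ Real.pi / 2
  map_zero : T 0 = ContinuousLinearMap.id ℂ X
  map_add : ∀ z ∈ sector δ, ∀ w ∈ sector δ, T (z + w) = (T z).comp (T w)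
  holomorphic : DifferentiableOn ℂ T (sector δ)
  tendsto_zero : ∀ δ' : ℝ, 0 < δ' → δ' < δ → ∀ x : X,
    Tendsto (fun z => T z x) (𝓝[sector δ'] 0) (𝓝 x)

/-- `A` is the (infinitesimal) generator of the one-parameter semigroup `(S t)`, `t ≥ 0`:
`x ∈ D(A)` and `A x = y` if and only if `(S t x - x) / t → y` as `t → 0+`. -/
def IsGenerator {X : Type*} [NormedAddCommGroup X] [NormedSpace ℂ X]
    (S : ℝ → X →L[ℂ] X) (A : X →ₗ.[ℂ] X) : Prop :=
  ∀ x y : X, (x, y) ∈ A.graph ↔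
    Tendsto (fun t : ℝ => t⁻¹ • (S t x - x)) (𝓝[>] 0) (𝓝 y)

/-- The growth bound of `(S t)`, `t ≥ 0`: the infimum of all real `w` such that
`‖S t‖ ≤ M * exp (w * t)` for some `M` and all `t ≥ 0`. It may be `-∞`. -/
def growthBound {X : Type*} [NormedAddCommGroup X] [NormedSpace ℂ X]
    (S : ℝ → X →L[ℂ] X) : EReal :=
  sInf ((fun w : ℝ => (w : EReal)) ''
    {w : ℝ | ∃ M : ℝ, ∀ t : ℝ, 0 ≤ t → ‖S t‖ ≤ M * Real.exp (w * t)})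

/-- The negative fractional power of order `γ > 0`
`(l - A)^(-γ) = 1/Γ(γ) * ∫_0^∞ t^(γ-1) e^(-l t) S(t) dt`, where `A` generates `(S t)` and
`l` exceeds the growth bound. For an analytic semigroup the integrand is norm continuous on
`(0, ∞)` and the integral converges absolutely in operator norm. -/
def negFracPow {X : Type*} [NormedAddCommGroup X] [NormedSpace ℂ X]
    (S : ℝ → X →L[ℂ] X) (l γ : ℝ) : X →L[ℂ] X :=
  (Real.Gamma γ)⁻¹ • ∫ t in Ioi (0 : ℝ), (t ^ (γ - 1) * Real.exp (-(l * t))) • S t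

/-- The fractional power `(l - A)^γ` for `γ > 0`: the unbounded operator inverse to the injective
bounded operator `(l - A)^(-γ)`; its domain is the range of `(l - A)^(-γ)`. -/
def fracPow {X : Type*} [NormedAddCommGroup X] [NormedSpace ℂ X]
    (S : ℝ → X →L[ℂ] X) (l γ : ℝ) : X →ₗ.[ℂ] X :=
  (((negFracPow S l γ : X →L[ℂ] X) : X →ₗ[ℂ] X).toPMap ⊤).inverse

/-- The graph norm `‖x‖ + ‖L x‖` on the domain of `L`. -/
def graphNorm {X Y : Type*} [NormedAddCommGroup X] [NormedSpace ℂ X]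
    [NormedAddCommGroup Y] [NormedSpace ℂ Y] (L : X →ₗ.[ℂ] Y) (x : L.domain) : ℝ :=
  ‖(x : X)‖ + ‖L x‖

/-- `[D(L)] ↪ [D(K)]`: the domain of `L` is contained in the domain of `K`, and the inclusion map
is continuous for the graph norms. -/
def DomainEmbeds {X Y Z : Type*} [NormedAddCommGroup X] [NormedSpace ℂ X]
    [NormedAddCommGroup Y] [NormedSpace ℂ Y] [NormedAddCommGroup Z] [NormedSpace ℂ Z]
    (L : X →ₗ.[ℂ] Y) (K : X →ₗ.[ℂ] Z) : Prop :=
  ∃ h : L.domain ≤ K.domain, ∃ C : ℝ, ∀ x : L.domain,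
    graphNorm K (Submodule.inclusion h x) ≤ C * graphNorm L x

end AnalyticSG

end

/-! The operator `K (λ - A)^(-γ)` is bounded because `K` may be taken under the integral. Cauchy's
estimate gives `‖A T(t)‖ = O(1/t)` near `0`, so the hypothesis with `ρ = 1/t` yields `‖K T(t)‖ =
O(t^(-α))`. For larger `t`, `ρ = ρ₀` and `A T(t) = A T(r) T(t - r)` give `O(e^(wt))`, with `ω(A) ≤ w
< λ` (`exists_norm_apply_le`). Against `t^(γ-1) e^(-λt)` this is integrable since `γ > α`, and
closedness of `K` moves it inside (`exists_negFracPow_mem_graph`). Inverting the negative power also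
needs its injectivity (`negFracPow_injective`). -/

namespace AnalyticSG

/-! ### Integrals against the weight `t^(γ-1) e^(-lt)` -/

section Weighted

variable {E : Type*} [NormedAddCommGroup E] [NormedSpace ℝ E]

theorem integrableOn_weight {α γ l w : ℝ} (hα : 0 ≤ α) (hγ : α < γ) (hw : w < l) :
    IntegrableOn (fun t : ℝ => (t ^ (γ - 1) * Real.exp (-(l * t))) *
      ((t ^ (-α) + 1) * Real.exp (w * t))) (Ioi 0) := by
  have h1 : IntegrableOn (fun t : ℝ => t ^ (γ - α - 1) * Real.exp (-(l - w) * t ^ (1 : ℝ)))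
      (Ioi 0) :=
    integrableOn_rpow_mul_exp_neg_mul_rpow (by linarith) one_pos (by linarith)
  have h2 : IntegrableOn (fun t : ℝ => t ^ (γ - 1) * Real.exp (-(l - w) * t ^ (1 : ℝ)))
      (Ioi 0) :=
    integrableOn_rpow_mul_exp_neg_mul_rpow (by linarith) one_pos (by linarith)
  refine (h1.add h2).congr_fun (fun t ht => ?_) measurableSet_Ioi
  have ht : 0 < t := ht
  have e1 : t ^ (γ - α - 1) = t ^ (γ - 1) * t ^ (-α) := by
    rw [← Real.rpow_add ht]; ring_nf
  have e2 : Real.exp (-(l - w) * t ^ (1 : ℝ)) = Real.exp (-(l * t)) * Real.exp (w * t) := by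
    rw [← Real.exp_add, Real.rpow_one]; ring_nf
  simp only [Pi.add_apply]
  rw [e1, e2]; ring

theorem continuousOn_weight (γ l : ℝ) :
    ContinuousOn (fun t : ℝ => t ^ (γ - 1) * Real.exp (-(l * t))) (Ioi 0) := by
  refine ContinuousOn.mul (fun t ht => ?_) (by fun_prop)
  exact (Real.continuousAt_rpow_const t _ (Or.inl (ne_of_gt ht))).continuousWithinAt

theorem norm_weight_smul_le {α γ l w C : ℝ} {f : ℝ → E}
    (hb : ∀ t, 0 < t → ‖f t‖ ≤ C * ((t ^ (-α) + 1) * Real.exp (w * t))) {t : ℝ} (ht : 0 < t) :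
    ‖(t ^ (γ - 1) * Real.exp (-(l * t))) • f t‖ ≤
      C * ((t ^ (γ - 1) * Real.exp (-(l * t))) * ((t ^ (-α) + 1) * Real.exp (w * t))) := by
  rw [norm_smul, Real.norm_of_nonneg (by positivity)]
  calc _ ≤ (t ^ (γ - 1) * Real.exp (-(l * t))) * (C * ((t ^ (-α) + 1) * Real.exp (w * t))) := by
        gcongr; exact hb t ht
    _ = _ := by ring

theorem integrableOn_weight_smul {α γ l w C : ℝ} (hα : 0 ≤ α) (hγ : α < γ) (hw : w < l)
    {f : ℝ → E} (hf : ContinuousOn f (Ioi 0))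
    (hb : ∀ t, 0 < t → ‖f t‖ ≤ C * ((t ^ (-α) + 1) * Real.exp (w * t))) :
    IntegrableOn (fun t : ℝ => (t ^ (γ - 1) * Real.exp (-(l * t))) • f t) (Ioi 0) := by
  refine Integrable.mono' ((integrableOn_weight hα hγ hw).const_mul C)
    (((continuousOn_weight γ l).smul hf).aestronglyMeasurable measurableSet_Ioi) ?_
  filter_upwards [ae_restrict_mem measurableSet_Ioi] with t ht
  exact norm_weight_smul_le hb ht

theorem norm_integral_weight_smul_le {α γ l w C : ℝ} (hα : 0 ≤ α) (hγ : α < γ) (hw : w < l)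
    {f : ℝ → E} (hb : ∀ t, 0 < t → ‖f t‖ ≤ C * ((t ^ (-α) + 1) * Real.exp (w * t))) :
    ‖∫ t in Ioi (0 : ℝ), (t ^ (γ - 1) * Real.exp (-(l * t))) • f t‖ ≤
      C * ∫ t in Ioi (0 : ℝ), (t ^ (γ - 1) * Real.exp (-(l * t))) *
        ((t ^ (-α) + 1) * Real.exp (w * t)) := by
  rw [← integral_const_mul]
  refine norm_integral_le_of_norm_le ((integrableOn_weight hα hγ hw).const_mul C) ?_
  filter_upwards [ae_restrict_mem measurableSet_Ioi] with t ht
  exact norm_weight_smul_le hb ht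

end Weighted

/-- The quotient map by `p` commutes with the integral and kills the integrand; closedness makes the
quotient a normed space. -/
theorem integral_mem_of_isClosed {ι E : Type*} [MeasurableSpace ι] {μ : Measure ι}
    [NormedAddCommGroup E] [NormedSpace ℂ E] [CompleteSpace E] {p : Submodule ℂ E}
    (hp : IsClosed (p : Set E)) {f : ι → E} (hf : Integrable f μ) (hm : ∀ᵐ x ∂μ, f x ∈ p) :
    ∫ x, f x ∂μ ∈ p := by
  have : IsClosed (p : Set E) := hp
  have h := p.mkQL.integral_comp_comm hf
  rw [← p.ker_mkQ, LinearMap.mem_ker, ← p.mkQL_apply, ← h]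
  refine integral_eq_zero_of_ae ?_
  filter_upwards [hm] with x hx
  simpa using hx

theorem integral_beta {a b x : ℝ} (ha : 0 < a) (hb : 0 < b) (hx : 0 < x) :
    ∫ t in 0..x, t ^ (a - 1) * (x - t) ^ (b - 1) =
      x ^ (a + b - 1) * (Real.Gamma a * Real.Gamma b / Real.Gamma (a + b)) := by
  have h := Complex.betaIntegral_scaled a b hx
  rw [Complex.betaIntegral_eq_Gamma_mul_div _ _ (by simpa) (by simpa)] at h
  apply Complex.ofReal_injective
  rw [← intervalIntegral.integral_ofReal]
  have e : ∫ t in 0..x, ((t ^ (a - 1) * (x - t) ^ (b - 1) : ℝ) : ℂ) =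
      ∫ t in 0..x, (t : ℂ) ^ ((a : ℂ) - 1) * ((x : ℂ) - t) ^ ((b : ℂ) - 1) := by
    refine intervalIntegral.integral_congr fun t ht => ?_
    rw [uIcc_of_le hx.le] at ht
    rw [Complex.ofReal_mul, Complex.ofReal_cpow ht.1, Complex.ofReal_cpow (by linarith [ht.2])]
    push_cast; rfl
  rw [e, h]
  push_cast [Complex.ofReal_cpow hx.le, Complex.Gamma_ofReal]
  rw [← Complex.ofReal_add, Complex.Gamma_ofReal]

/-! ### Negative fractional powers: composition law and injectivity -/

section FractionalPower

variable {X : Type*} [NormedAddCommGroup X] [NormedSpace ℂ X]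

/-- A semigroup on `(0, ∞)`, norm continuous there, strongly continuous at `0` and of
exponential growth at most `w`. -/
structure IsExpBoundedSemigroup (S : ℝ → X →L[ℂ] X) (M w : ℝ) : Prop where
  map_add : ∀ s, 0 < s → ∀ t, 0 < t → S (s + t) = (S s).comp (S t)
  continuousOn : ContinuousOn S (Ioi 0)
  tendsto_zero : ∀ x, Tendsto (fun t => S t x) (𝓝[>] 0) (𝓝 x)
  nonneg : 0 ≤ M
  bound : ∀ t, 0 < t → ‖S t‖ ≤ M * Real.exp (w * t)

namespace IsExpBoundedSemigroup

variable {S : ℝ → X →L[ℂ] X} {M w l : ℝ}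

theorem integrableOn (hS : IsExpBoundedSemigroup S M w) (hw : w < l) {γ : ℝ} (hγ : 0 < γ) :
    IntegrableOn (fun t : ℝ => (t ^ (γ - 1) * Real.exp (-(l * t))) • S t) (Ioi 0) := by
  refine integrableOn_weight_smul (C := M) le_rfl hγ hw hS.continuousOn fun t ht => ?_
  refine (hS.bound t ht).trans (mul_le_mul_of_nonneg_left ?_ hS.nonneg)
  have : 0 ≤ t ^ (-(0 : ℝ)) := by positivity
  nlinarith [Real.exp_pos (w * t)]

theorem negFracPow_apply [CompleteSpace X] (hS : IsExpBoundedSemigroup S M w) (hw : w < l) {γ : ℝ}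
    (hγ : 0 < γ) (x : X) :
    negFracPow S l γ x = (Real.Gamma γ)⁻¹ •
      ∫ t in Ioi (0 : ℝ), (t ^ (γ - 1) * Real.exp (-(l * t))) • S t x := by
  unfold negFracPow
  rw [smul_apply, ContinuousLinearMap.integral_apply (hS.integrableOn hw hγ)]
  rfl

/-- The product of the integrals is the integral of the convolution. There `S t * S (x - t) = S x`
comes out, leaving a scalar Beta integral. -/
theorem negFracPow_comp [CompleteSpace X] (hS : IsExpBoundedSemigroup S M w) (hw : w < l)
    {a b : ℝ} (ha : 0 < a) (hb : 0 < b) :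
    (negFracPow S l a).comp (negFracPow S l b) = negFracPow S l (a + b) := by
  have h := integral_posConvolution (hS.integrableOn hw ha) (hS.integrableOn hw hb)
    (ContinuousLinearMap.mul ℝ (X →L[ℂ] X))
  have hΓ := (Real.Gamma_pos_of_pos ha).ne'
  have hΓ' := (Real.Gamma_pos_of_pos hb).ne'
  have e : ∫ x in Ioi (0 : ℝ), ∫ t in 0..x, (ContinuousLinearMap.mul ℝ (X →L[ℂ] X))
      ((t ^ (a - 1) * Real.exp (-(l * t))) • S t)
      (((x - t) ^ (b - 1) * Real.exp (-(l * (x - t)))) • S (x - t)) =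
      ∫ x in Ioi (0 : ℝ), (Real.Gamma a * Real.Gamma b / Real.Gamma (a + b)) •
        ((x ^ (a + b - 1) * Real.exp (-(l * x))) • S x) := by
    refine setIntegral_congr_fun measurableSet_Ioi fun x hx => ?_
    have hx : 0 < x := hx
    have e1 : ∫ t in 0..x, (ContinuousLinearMap.mul ℝ (X →L[ℂ] X))
        ((t ^ (a - 1) * Real.exp (-(l * t))) • S t)
        (((x - t) ^ (b - 1) * Real.exp (-(l * (x - t)))) • S (x - t)) =
        ∫ t in 0..x, (t ^ (a - 1) * (x - t) ^ (b - 1)) • (Real.exp (-(l * x)) • S x) := by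
      rw [intervalIntegral.integral_of_le hx.le, intervalIntegral.integral_of_le hx.le,
        integral_Ioc_eq_integral_Ioo, integral_Ioc_eq_integral_Ioo]
      refine setIntegral_congr_fun measurableSet_Ioo fun t ht => ?_
      have hm : S x = S t * S (x - t) := by
        have := hS.map_add t ht.1 (x - t) (by linarith [ht.2])
        rwa [add_sub_cancel] at this
      have he : Real.exp (-(l * x)) = Real.exp (-(l * t)) * Real.exp (-(l * (x - t))) := by
        rw [← Real.exp_add]; ring_nf
      simp only [ContinuousLinearMap.mul_apply']
      rw [hm, he, smul_mul_smul_comm, smul_smul]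
      congr 1; ring
    rw [e1, intervalIntegral.integral_smul_const, integral_beta ha hb hx, smul_smul, smul_smul]
    congr 1; ring
  rw [e, integral_smul] at h
  unfold negFracPow
  rw [← ContinuousLinearMap.mul_def, smul_mul_smul_comm]
  simp only [ContinuousLinearMap.mul_apply'] at h
  rw [← h, smul_smul]
  congr 1
  field_simp

/-- If the integral over `(0, ∞)` vanishes, applying `S s` shows that every tail does.
Differentiating the primitive gives `S s x = 0` for `s > 0`, and `s → 0` gives `x = 0`. -/
theorem negFracPow_one_injective [CompleteSpace X] (hS : IsExpBoundedSemigroup S M w) (hw : w < l) :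
    Function.Injective (negFracPow S l 1) := by
  rw [injective_iff_map_eq_zero]
  intro x hx
  set h : ℝ → X := fun t => Real.exp (-(l * t)) • S t x with h_def
  have hi : IntegrableOn h (Ioi 0) := by
    refine IntegrableOn.congr_fun
      (Integrable.apply_continuousLinearMap (hS.integrableOn hw one_pos) x)
      (fun t _ => ?_) measurableSet_Ioi
    simp [h_def]
  have hc : ContinuousOn h (Ioi 0) := by
    exact ContinuousOn.smul (M := ℝ)
      (by fun_prop) (hS.continuousOn.clm_apply continuousOn_const)
  rw [hS.negFracPow_apply hw one_pos] at hx
  simp only [Real.Gamma_one, inv_one, one_smul, sub_self, Real.rpow_zero, one_mul] at hx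
  have htail : ∀ s, 0 < s → ∫ t in Ioi s, h t = 0 := by
    intro s hs
    have h1 : ∫ t in Ioi (0 : ℝ), S s (h t) = 0 := by
      rw [(S s).integral_comp_comm hi, hx, map_zero]
    have h2 : ∫ t in Ioi s, h t = ∫ t in Ioi (0 : ℝ), h (t + s) := by
      rw [← (measurePreserving_add_right volume s).setIntegral_preimage_emb
        (measurableEmbedding_addRight s), preimage_add_const_Ioi, sub_self]
    rw [h2]
    have h3 : ∫ t in Ioi (0 : ℝ), h (t + s) =
        ∫ t in Ioi (0 : ℝ), Real.exp (-(l * s)) • S s (h t) := by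
      refine setIntegral_congr_fun measurableSet_Ioi fun t ht => ?_
      have he : Real.exp (-(l * (t + s))) = Real.exp (-(l * s)) * Real.exp (-(l * t)) := by
        rw [← Real.exp_add]; ring_nf
      simp only [h_def]
      rw [he, add_comm t s, hS.map_add s hs t ht, mul_smul]
      congr 1
      simp
    rw [h3, integral_smul, h1, smul_zero]
  have hzero : ∀ s, 0 < s → ∫ t in 0..s, h t = 0 := by
    intro s hs
    have := intervalIntegral.integral_interval_add_Ioi' (a := 0) (b := s) (μ := volume) (f := h)
      ((intervalIntegrable_iff_integrableOn_Ioc_of_le hs.le).2 (hi.mono_set Ioc_subset_Ioi_self))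
      (hi.mono_set (Ioi_subset_Ioi hs.le))
    rw [htail s hs, add_zero, hx] at this
    exact this
  have hs0 : ∀ s, 0 < s → S s x = 0 := by
    intro s hs
    have hd : HasDerivAt (fun u => ∫ t in 0..u, h t) (h s) s :=
      intervalIntegral.integral_hasDerivAt_right
        ((intervalIntegrable_iff_integrableOn_Ioc_of_le hs.le).2
          (hi.mono_set Ioc_subset_Ioi_self))
        (hc.stronglyMeasurableAtFilter isOpen_Ioi s hs) (hc.continuousAt (Ioi_mem_nhds hs))
    have hd' : HasDerivAt (fun u => ∫ t in 0..u, h t) 0 s :=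
      (hasDerivAt_const s (0 : X)).congr_of_eventuallyEq
        (by filter_upwards [Ioi_mem_nhds hs] with u hu using hzero u hu)
    have := hd.unique hd'
    simpa [h_def, Real.exp_ne_zero] using this
  refine tendsto_nhds_unique (hS.tendsto_zero x) ?_
  refine tendsto_const_nhds.congr' ?_
  filter_upwards [self_mem_nhdsWithin] with s hs using (hs0 s hs).symm

theorem negFracPow_injective [CompleteSpace X] (hS : IsExpBoundedSemigroup S M w) (hw : w < l)
    {γ : ℝ} (hγ : 0 < γ) : Function.Injective (negFracPow S l γ) := by
  have hn : ∀ n : ℕ, Function.Injective (negFracPow S l (n + 1)) := by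
    intro n
    induction n with
    | zero => simpa using hS.negFracPow_one_injective hw
    | succ n ih =>
      have := hS.negFracPow_comp hw (a := n + 1) (b := 1) (by positivity) one_pos
      push_cast
      rw [← this]
      exact ih.comp (hS.negFracPow_one_injective hw)
  -- The order `γ` power is the inner factor of the injective power of order `n + 1`.
  obtain ⟨n, hn'⟩ := exists_nat_gt γ
  have h := hn n
  have e := hS.negFracPow_comp hw (a := n + 1 - γ) (b := γ) (by linarith) hγ
  rw [sub_add_cancel] at e
  rw [← e] at h
  exact Function.Injective.of_comp (f := negFracPow S l (n + 1 - γ)) h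

end IsExpBoundedSemigroup

theorem fracPow_domainEmbeds {Y : Type*} [NormedAddCommGroup Y] [NormedSpace ℂ Y]
    {S : ℝ → X →L[ℂ] X} {l γ : ℝ}
    (hinj : Function.Injective (negFracPow S l γ)) (K : X →ₗ.[ℂ] Y) (C : ℝ)
    (hK : ∀ x, ∃ y, (negFracPow S l γ x, y) ∈ K.graph ∧ ‖y‖ ≤ C * ‖x‖) :
    DomainEmbeds (fracPow S l γ) K := by
  have hker : (((negFracPow S l γ : X →L[ℂ] X) : X →ₗ[ℂ] X).toPMap ⊤).toFun.ker = ⊥ := by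
    rw [LinearMap.ker_eq_bot]
    intro a b hab
    exact Subtype.ext (hinj hab)
  have hdom : ∀ x ∈ (fracPow S l γ).domain, ∃ z, negFracPow S l γ z = x := by
    intro x hx
    rw [fracPow, LinearPMap.inverse_domain] at hx
    obtain ⟨z, hz⟩ := hx
    exact ⟨z, hz⟩
  have hle : (fracPow S l γ).domain ≤ K.domain := by
    intro x hx
    obtain ⟨z, rfl⟩ := hdom x hx
    obtain ⟨y, hy, -⟩ := hK z
    exact LinearPMap.mem_domain_of_mem_graph hy
  refine ⟨hle, 1 + |C|, fun x => ?_⟩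
  obtain ⟨z, hz⟩ := hdom x x.2
  obtain ⟨y, hy, hyb⟩ := hK z
  have hL : fracPow S l γ x = z :=
    LinearPMap.inverse_apply_eq hker (x := ⟨z, trivial⟩) hz
  have hKy : K (Submodule.inclusion hle x) = y := by
    rw [hz] at hy
    exact ((LinearPMap.image_iff (x := (x : X)) (hle x.2)).2 hy).symm
  unfold graphNorm
  rw [hL, hKy, Submodule.coe_inclusion]
  have := abs_nonneg C
  have := mul_le_mul_of_nonneg_right (le_abs_self C) (norm_nonneg z)
  nlinarith [norm_nonneg z, norm_nonneg (x : X), mul_nonneg (abs_nonneg C) (norm_nonneg (x : X))]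

end FractionalPower

/-! ### Analytic semigroups: derivative bounds and the estimate of `K T(t)` -/

theorem ofReal_mem_sector {δ t : ℝ} (hδ : 0 < δ) (ht : 0 < t) : (t : ℂ) ∈ sector δ := by
  refine ⟨by exact_mod_cast ht.ne', ?_⟩
  rwa [Complex.arg_ofReal_of_nonneg ht.le, abs_zero]

theorem sector_subset {δ δ' : ℝ} (h : δ' ≤ δ) : sector δ' ⊆ sector δ :=
  fun _ hz => ⟨hz.1, hz.2.trans_le h⟩

/-- A ball around `1` lies in the sector, which is invariant under scaling by `t > 0`. -/
theorem exists_closedBall_subset_sector {δ : ℝ} (hδ : 0 < δ) :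
    ∃ c : ℝ, 0 < c ∧ ∀ t : ℝ, 0 < t → Metric.closedBall (t : ℂ) (c * t) ⊆ sector δ := by
  have h1 : sector δ ∈ 𝓝 (1 : ℂ) := by
    have hc : ContinuousAt (fun z : ℂ => |Complex.arg z|) 1 :=
      (Complex.continuousAt_arg Complex.one_mem_slitPlane).abs
    exact (eventually_ne_nhds one_ne_zero).and
      (hc.eventually_lt continuousAt_const (by simpa using hδ))
  obtain ⟨c, hc, hcs⟩ := Metric.nhds_basis_closedBall.mem_iff.1 h1
  refine ⟨c, hc, fun t ht z hz => ?_⟩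
  have ht' : (t : ℂ) ≠ 0 := by exact_mod_cast ht.ne'
  have hu : z / t ∈ sector δ := by
    refine hcs ?_
    rw [mem_closedBall_iff_norm] at hz ⊢
    have : z / t - 1 = (z - t) / t := by field_simp
    rw [this, norm_div, Complex.norm_real, Real.norm_of_nonneg ht.le, div_le_iff₀ ht]
    exact hz
  refine ⟨fun h => hu.1 (by simp [h]), ?_⟩
  have := hu.2
  rwa [← Complex.arg_real_mul _ ht, mul_div_cancel₀ _ ht'] at this

theorem exists_norm_le_of_growthBound_lt {X : Type*} [NormedAddCommGroup X] [NormedSpace ℂ X]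
    {S : ℝ → X →L[ℂ] X} {l : ℝ} (hl : growthBound S < (l : EReal)) :
    ∃ w < l, ∃ M : ℝ, ∀ t : ℝ, 0 ≤ t → ‖S t‖ ≤ M * Real.exp (w * t) := by
  obtain ⟨_, ⟨w, ⟨M, hM⟩, rfl⟩, hw⟩ := sInf_lt_iff.1 hl
  exact ⟨w, EReal.coe_lt_coe_iff.1 hw, M, hM⟩

namespace IsAnalyticSemigroup

variable {X : Type*} [NormedAddCommGroup X] [NormedSpace ℂ X] {δ : ℝ} {T : ℂ → X →L[ℂ] X}

theorem differentiableAt (hT : IsAnalyticSemigroup δ T) {t : ℝ} (ht : 0 < t) :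
    DifferentiableAt ℂ T t := by
  obtain ⟨c, hc, hcs⟩ := exists_closedBall_subset_sector hT.angle_pos
  exact hT.holomorphic.differentiableAt
    (mem_of_superset (Metric.closedBall_mem_nhds _ (mul_pos hc ht)) (hcs t ht))

theorem isExpBoundedSemigroup (hT : IsAnalyticSemigroup δ T) {M w : ℝ}
    (hb : ∀ t : ℝ, 0 ≤ t → ‖T t‖ ≤ M * Real.exp (w * t)) :
    IsExpBoundedSemigroup (fun t : ℝ => T t) M w where
  map_add s hs t ht := by
    rw [Complex.ofReal_add]
    exact hT.map_add _ (ofReal_mem_sector hT.angle_pos hs) _ (ofReal_mem_sector hT.angle_pos ht)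
  continuousOn t ht := by
    have h : ContinuousAt T ((t : ℝ) : ℂ) := (hT.differentiableAt ht).continuousAt
    exact (ContinuousAt.comp (f := Complex.ofReal) h
      Complex.continuous_ofReal.continuousAt).continuousWithinAt
  tendsto_zero x := by
    have hδ := hT.angle_pos
    refine (hT.tendsto_zero (δ / 2) (by linarith) (by linarith) x).comp ?_
    refine tendsto_nhdsWithin_iff.2 ⟨?_, ?_⟩
    · exact (Complex.continuous_ofReal.tendsto' 0 0 Complex.ofReal_zero).mono_left
        nhdsWithin_le_nhds
    · filter_upwards [self_mem_nhdsWithin] with t ht using ofReal_mem_sector (by linarith) ht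
  nonneg := by simpa using (norm_nonneg _).trans (hb 0 le_rfl)
  bound t ht := hb t ht.le

/-- Otherwise some `z n → 0` has `‖T (z n)‖ > n`, against uniform boundedness along this strongly
convergent sequence. -/
theorem exists_norm_le_near_zero [CompleteSpace X] (hT : IsAnalyticSemigroup δ T) {δ' : ℝ}
    (h0 : 0 < δ') (h1 : δ' < δ) :
    ∃ r : ℝ, 0 < r ∧ ∃ C : ℝ, ∀ z ∈ sector δ', ‖z‖ < r → ‖T z‖ ≤ C := by
  by_contra! hcon
  choose z hz hzr hzT using fun n : ℕ =>
    hcon (1 / ((n : ℝ) + 1)) (by positivity) (n : ℝ)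
  have hlim : Tendsto z atTop (𝓝[sector δ'] 0) := by
    refine tendsto_nhdsWithin_iff.2 ⟨?_, Eventually.of_forall hz⟩
    exact squeeze_zero_norm (fun n => (hzr n).le) tendsto_one_div_add_atTop_nhds_zero_nat
  obtain ⟨C, hC⟩ := banach_steinhaus (g := fun n => T (z n)) fun x => by
    obtain ⟨C, hC⟩ := ((hT.tendsto_zero δ' h0 h1 x).comp hlim).norm.bddAbove_range
    exact ⟨C, fun n => hC ⟨n, rfl⟩⟩
  obtain ⟨n, hn⟩ := exists_nat_gt C
  linarith [hC n, hzT n]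

/-- Cauchy's estimate on the circle of radius `c * t` about `t`, inside the half-angle sector where
`T` is bounded near `0`. -/
theorem exists_norm_deriv_le [CompleteSpace X] (hT : IsAnalyticSemigroup δ T) :
    ∃ r : ℝ, 0 < r ∧ ∃ C : ℝ, 0 ≤ C ∧ ∀ t : ℝ, 0 < t → t ≤ r → ‖deriv T t‖ ≤ C / t := by
  have hδ := hT.angle_pos
  obtain ⟨r, hr, C, hC⟩ := hT.exists_norm_le_near_zero (δ' := δ / 2) (by linarith) (by linarith)
  obtain ⟨c, hc, hcs⟩ := exists_closedBall_subset_sector (half_pos hδ)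
  refine ⟨r / (2 * (1 + c)), by positivity, |C| / c, by positivity, fun t ht htr => ?_⟩
  rw [div_div]
  refine Complex.norm_deriv_le_of_forall_mem_sphere_norm_le (mul_pos hc ht) ?_ fun z hz => ?_
  · refine DifferentiableOn.diffContOnCl (hT.holomorphic.mono ?_)
    exact Metric.closure_ball_subset_closedBall.trans
      ((hcs t ht).trans (sector_subset (by linarith)))
  · refine (hC z (hcs t ht (Metric.sphere_subset_closedBall hz)) ?_).trans (le_abs_self C)
    rw [mem_sphere_iff_norm] at hz
    have h1 : ‖z‖ ≤ ‖z - t‖ + ‖(t : ℂ)‖ := by simpa using norm_add_le (z - t) t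
    rw [hz, Complex.norm_real, Real.norm_of_nonneg ht.le] at h1
    rw [le_div_iff₀ (by positivity)] at htr
    nlinarith

theorem deriv_mem_graph (hT : IsAnalyticSemigroup δ T) {A : X →ₗ.[ℂ] X}
    (hA : IsGenerator (fun t : ℝ => T (t : ℂ)) A) {t : ℝ} (ht : 0 < t) (x : X) :
    (T t x, deriv T t x) ∈ A.graph := by
  rw [hA]
  have h1 : HasDerivAt (fun s : ℝ => T (s : ℂ)) (deriv T t) t :=
    by simpa using! (hT.differentiableAt ht).hasDerivAt.scomp t Complex.ofRealCLM.hasDerivAt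
  have h2 := (hasDerivAt_iff_tendsto_slope_zero.1 h1).mono_left
    (nhdsWithin_mono _ fun s (hs : 0 < s) => ne_of_gt hs)
  have h3 := ((ContinuousLinearMap.apply ℂ X x).continuous.tendsto _).comp h2
  refine h3.congr' ?_
  filter_upwards [self_mem_nhdsWithin] with s hs
  have hs : 0 < s := hs
  have := hT.map_add _ (ofReal_mem_sector hT.angle_pos hs) _ (ofReal_mem_sector hT.angle_pos ht)
  simp only [Function.comp_apply, ContinuousLinearMap.apply_apply]
  rw [add_comm t s, Complex.ofReal_add, this]
  simp

theorem deriv_add (hT : IsAnalyticSemigroup δ T) {A : X →ₗ.[ℂ] X}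
    (hA : IsGenerator (fun t : ℝ => T (t : ℂ)) A) {s t : ℝ} (hs : 0 < s) (ht : 0 < t) :
    deriv T ((s + t : ℝ) : ℂ) = (deriv T s).comp (T t) := by
  ext x
  have h1 := hT.deriv_mem_graph hA (add_pos hs ht) x
  have h2 := hT.deriv_mem_graph hA hs (T t x)
  have h3 : T ((s + t : ℝ) : ℂ) x = T s (T t x) := by
    rw [Complex.ofReal_add,
      hT.map_add _ (ofReal_mem_sector hT.angle_pos hs) _ (ofReal_mem_sector hT.angle_pos ht)]
    rfl
  exact LinearPMap.mem_graph_snd_inj A h1 h2 h3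

theorem exists_norm_apply_le [CompleteSpace X] {Y : Type*} [NormedAddCommGroup Y]
    [NormedSpace ℂ Y] (hT : IsAnalyticSemigroup δ T) {A : X →ₗ.[ℂ] X}
    (hA : IsGenerator (fun t : ℝ => T (t : ℂ)) A) {K : X →ₗ.[ℂ] Y} (hAK : A.domain ≤ K.domain)
    {α M ρ₀ : ℝ} (hM : 0 ≤ M) (hρ₀ : 0 < ρ₀)
    (hest : ∀ ρ : ℝ, ρ₀ ≤ ρ → ∀ x : A.domain,
      ‖K (Submodule.inclusion hAK x)‖ ≤
        M * (ρ ^ α * ‖(x : X)‖ + ρ ^ (α - 1) * ‖A x‖))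
    {M' w : ℝ} (hb : ∀ t : ℝ, 0 ≤ t → ‖T t‖ ≤ M' * Real.exp (w * t)) :
    ∃ C : ℝ, 0 ≤ C ∧ ∀ t : ℝ, 0 < t → ∀ x : X, ∃ y, (T t x, y) ∈ K.graph ∧
      ‖y‖ ≤ C * ((t ^ (-α) + 1) * Real.exp (w * t)) * ‖x‖ := by
  have hM' : 0 ≤ M' := by simpa using (norm_nonneg _).trans (hb 0 le_rfl)
  obtain ⟨r', hr', D, hD, hderiv'⟩ := hT.exists_norm_deriv_le
  -- `r ≤ ρ₀⁻¹` makes `ρ = t⁻¹` admissible for `t ≤ r`.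
  set r := min r' ρ₀⁻¹ with hr_def
  have hr : 0 < r := lt_min hr' (inv_pos.2 hρ₀)
  have hderiv : ∀ t : ℝ, 0 < t → t ≤ r → ‖deriv T t‖ ≤ D / t := fun t ht h =>
    hderiv' t ht (h.trans (min_le_left _ _))
  have key : ∀ ρ : ℝ, ρ₀ ≤ ρ → ∀ t : ℝ, 0 < t → ∀ x : X, ∃ y, (T t x, y) ∈ K.graph ∧
      ‖y‖ ≤ M * (ρ ^ α * ‖T t‖ + ρ ^ (α - 1) * ‖deriv T t‖) * ‖x‖ := by
    intro ρ hρ t ht x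
    have hg := hT.deriv_mem_graph hA ht x
    have hd := LinearPMap.mem_domain_of_mem_graph hg
    have hAx : A ⟨T t x, hd⟩ = deriv T t x := ((LinearPMap.image_iff hd).2 hg).symm
    refine ⟨K ⟨T t x, hAK hd⟩, K.mem_graph ⟨T t x, hAK hd⟩, ?_⟩
    have h := hest ρ hρ ⟨T t x, hd⟩
    rw [hAx] at h
    refine h.trans ?_
    have hρ' : 0 < ρ := hρ₀.trans_le hρ
    rw [mul_assoc, add_mul, mul_assoc, mul_assoc]
    gcongr
    · exact (T t).le_opNorm x
    · exact (deriv T t).le_opNorm x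
  -- `E` offsets the factors `e^(wt)`, `t ≤ r`, and `e^(-wr)` for either sign of `w`.
  set E := Real.exp (|w| * r) with hE
  have hEt : ∀ t : ℝ, 0 ≤ t → t ≤ r → 1 ≤ E * Real.exp (w * t) := by
    intro t ht htr
    rw [hE, ← Real.exp_add, Real.one_le_exp_iff]
    have := neg_abs_le w
    have := mul_le_mul_of_nonneg_left htr (abs_nonneg w)
    nlinarith
  set C₁ := M * (M' + D * E) with hC₁
  set C₂ := M * (ρ₀ ^ α * M' + ρ₀ ^ (α - 1) * (D / r * (M' * E))) with hC₂
  have hC₁0 : 0 ≤ C₁ := by positivity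
  have hC₂0 : 0 ≤ C₂ := by positivity
  refine ⟨C₁ + C₂, by positivity, fun t ht x => ?_⟩
  have hta : 0 ≤ t ^ (-α) := by positivity
  rcases le_or_gt t r with htr | htr
  · have hρ : ρ₀ ≤ t⁻¹ := by
      rw [le_inv_comm₀ hρ₀ ht]; exact htr.trans (min_le_right _ _)
    obtain ⟨y, hy, hyb⟩ := key _ hρ t ht x
    refine ⟨y, hy, hyb.trans (mul_le_mul_of_nonneg_right ?_ (norm_nonneg x))⟩
    have e1 : t⁻¹ ^ α = t ^ (-α) := by rw [Real.inv_rpow ht.le, Real.rpow_neg ht.le]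
    have e2 : t⁻¹ ^ (α - 1) = t ^ (-α) * t := by
      rw [Real.inv_rpow ht.le, ← Real.rpow_neg ht.le, neg_sub, sub_eq_add_neg, add_comm,
        Real.rpow_add ht, Real.rpow_one]
    have h1 : M * (t⁻¹ ^ α * ‖T t‖ + t⁻¹ ^ (α - 1) * ‖deriv T t‖) ≤
        C₁ * (t ^ (-α) * Real.exp (w * t)) := by
      rw [e1, e2, hC₁, mul_assoc M]
      gcongr
      have h2 : t ^ (-α) * ‖T t‖ ≤ t ^ (-α) * (M' * Real.exp (w * t)) := by
        gcongr; exact hb t ht.le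
      have h3 : t ^ (-α) * t * ‖deriv T t‖ ≤ t ^ (-α) * (D * (E * Real.exp (w * t))) := by
        rw [mul_assoc]
        refine mul_le_mul_of_nonneg_left ?_ hta
        calc t * ‖deriv T t‖ ≤ t * (D / t) := by gcongr; exact hderiv t ht htr
          _ = D * 1 := by field_simp
          _ ≤ _ := by gcongr; exact hEt t ht.le htr
      linarith
    refine h1.trans ?_
    gcongr
    · linarith
    · linarith
  · obtain ⟨y, hy, hyb⟩ := key _ le_rfl t ht x
    refine ⟨y, hy, hyb.trans (mul_le_mul_of_nonneg_right ?_ (norm_nonneg x))⟩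
    have h1 : M * (ρ₀ ^ α * ‖T t‖ + ρ₀ ^ (α - 1) * ‖deriv T t‖) ≤
        C₂ * (1 * Real.exp (w * t)) := by
      rw [hC₂, mul_assoc M]
      gcongr
      have h2 : ρ₀ ^ α * ‖T t‖ ≤ ρ₀ ^ α * (M' * Real.exp (w * t)) := by
        gcongr; exact hb t ht.le
      have h3 : ρ₀ ^ (α - 1) * ‖deriv T t‖ ≤
          ρ₀ ^ (α - 1) * (D / r * (M' * E * Real.exp (w * t))) := by
        gcongr
        have hsub : 0 < t - r := sub_pos.2 htr
        have h4 := hT.deriv_add hA hr hsub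
        rw [add_sub_cancel] at h4
        rw [h4]
        refine (ContinuousLinearMap.opNorm_comp_le _ _).trans ?_
        refine mul_le_mul (hderiv r hr le_rfl) ((hb _ hsub.le).trans ?_) (norm_nonneg _)
          (by positivity)
        rw [mul_assoc, hE, ← Real.exp_add]
        gcongr
        have := neg_abs_le w
        nlinarith
      linarith
    refine h1.trans ?_
    gcongr
    · linarith
    · linarith

end IsAnalyticSemigroup

/-! ### Closed operators under the integral -/

theorem IsExpBoundedSemigroup.exists_negFracPow_mem_graph {X : Type*} [NormedAddCommGroup X]
    [NormedSpace ℂ X] [CompleteSpace X] {Y : Type*} [NormedAddCommGroup Y]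
    [NormedSpace ℂ Y] [CompleteSpace Y] {S : ℝ → X →L[ℂ] X} {M w l : ℝ}
    (hS : IsExpBoundedSemigroup S M w) (hw : w < l) {K : X →ₗ.[ℂ] Y} (hK : K.IsClosed)
    {α γ C : ℝ} (hα : 0 ≤ α) (hγ : α < γ)
    (hKS : ∀ t : ℝ, 0 < t → ∀ x : X, ∃ y, (S t x, y) ∈ K.graph ∧
      ‖y‖ ≤ C * ((t ^ (-α) + 1) * Real.exp (w * t)) * ‖x‖) :
    ∃ C' : ℝ, ∀ x, ∃ y, (negFracPow S l γ x, y) ∈ K.graph ∧ ‖y‖ ≤ C' * ‖x‖ := by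
  refine ⟨(Real.Gamma γ)⁻¹ * (C * ∫ t in Ioi (0 : ℝ), (t ^ (γ - 1) * Real.exp (-(l * t))) *
        ((t ^ (-α) + 1) * Real.exp (w * t))), fun x => ?_⟩
  choose! B hB hBn using hKS
  have hΓ := Real.Gamma_pos_of_pos (hα.trans_lt hγ)
  have hcont : ContinuousOn (fun t => B t x) (Ioi 0) := by
    intro t₀ ht₀
    have ht₀ : 0 < t₀ := ht₀
    set s := t₀ / 2 with hs_def
    have hs : 0 < s := half_pos ht₀
    set c := C * ((s ^ (-α) + 1) * Real.exp (w * s)) with hc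
    -- `K S(s)` is bounded, so factoring out `S s` reduces continuity of `t ↦ K S(t) x` to that of
    -- `S`.
    have hle : ∀ t, s < t → ‖B t x - B t₀ x‖ ≤ c * ‖S (t - s) x - S (t₀ - s) x‖ := by
      intro t ht
      have hsplit : ∀ t, s < t → S t x = S s (S (t - s) x) := fun t ht => by
        have := hS.map_add s hs (t - s) (sub_pos.2 ht)
        rw [add_sub_cancel] at this
        rw [this]; rfl
      have h1 := K.graph.sub_mem (hB t (hs.trans ht) x) (hB t₀ ht₀ x)
      rw [Prod.mk_sub_mk, hsplit t ht, hsplit t₀ (half_lt_self ht₀), ← map_sub] at h1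
      have h2 := hB s hs (S (t - s) x - S (t₀ - s) x)
      rw [LinearPMap.mem_graph_snd_inj K h1 h2 rfl]
      exact hBn s hs _
    have hcS : ContinuousAt (fun t => S (t - s) x) t₀ := by
      have h1 : ContinuousAt S (t₀ - s) :=
        hS.continuousOn.continuousAt (Ioi_mem_nhds (sub_pos.2 (half_lt_self ht₀)))
      have h2 : ContinuousAt (fun t => S (t - s)) t₀ :=
        ContinuousAt.comp (f := fun t : ℝ => t - s) h1 (by fun_prop)
      exact h2.clm_apply continuousAt_const
    refine ContinuousAt.continuousWithinAt ?_
    rw [ContinuousAt, tendsto_iff_norm_sub_tendsto_zero]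
    refine squeeze_zero' (Eventually.of_forall fun _ => norm_nonneg _)
      (by filter_upwards [Ioi_mem_nhds (half_lt_self ht₀)] with t ht using hle t ht) ?_
    simpa using (tendsto_iff_norm_sub_tendsto_zero.1 hcS).const_mul c
  have hbound : ∀ t, 0 < t → ‖B t x‖ ≤ (C * ‖x‖) * ((t ^ (-α) + 1) * Real.exp (w * t)) :=
    fun t ht => (hBn t ht x).trans_eq (by ring)
  have hBi := integrableOn_weight_smul (l := l) hα hγ hw hcont hbound
  have hSi : IntegrableOn (fun t : ℝ => (t ^ (γ - 1) * Real.exp (-(l * t))) • S t x) (Ioi 0) :=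
    Integrable.apply_continuousLinearMap (hS.integrableOn hw (hα.trans_lt hγ)) x
  refine ⟨(Real.Gamma γ)⁻¹ • ∫ t in Ioi (0 : ℝ), (t ^ (γ - 1) * Real.exp (-(l * t))) • B t x,
    ?_, ?_⟩
  -- The pairs `(S t x, B t x)` lie in the closed graph of `K`, hence so does their weighted
  -- integral.
  · rw [hS.negFracPow_apply hw (hα.trans_lt hγ), ← Prod.smul_mk, ← integral_pair hSi hBi]
    refine K.graph.smul_of_tower_mem (Real.Gamma γ)⁻¹
      (integral_mem_of_isClosed hK (hSi.prodMk hBi) ?_)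
    filter_upwards [ae_restrict_mem measurableSet_Ioi] with t ht
    rw [← Prod.smul_mk]
    exact K.graph.smul_of_tower_mem _ (hB t ht x)
  · rw [norm_smul, Real.norm_of_nonneg (inv_nonneg.2 hΓ.le), mul_assoc]
    gcongr
    exact (norm_integral_weight_smul_le hα hγ hw hbound).trans_eq (by ring)

end AnalyticSG

theorem lemmaA2 {X Y : Type*}
    [NormedAddCommGroup X] [NormedSpace ℂ X] [CompleteSpace X]
    [NormedAddCommGroup Y] [NormedSpace ℂ Y] [CompleteSpace Y]
    (δ : ℝ) (T : ℂ → X →L[ℂ] X) (hT : AnalyticSG.IsAnalyticSemigroup δ T)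
    (A : X →ₗ.[ℂ] X) (hA : AnalyticSG.IsGenerator (fun t : ℝ => T (t : ℂ)) A)
    (K : X →ₗ.[ℂ] Y) (hK : K.IsClosed) (hAK : A.domain ≤ K.domain)
    (α : ℝ) (hα0 : 0 < α) (hα1 : α < 1)
    (M ρ₀ : ℝ) (hM : 0 ≤ M) (hρ₀ : 0 < ρ₀)
    (hest : ∀ ρ : ℝ, ρ₀ ≤ ρ → ∀ x : A.domain,
      ‖K (Submodule.inclusion hAK x)‖ ≤
        M * (ρ ^ α * ‖(x : X)‖ + ρ ^ (α - 1) * ‖A x‖))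
    (γ : ℝ) (hγ : α < γ)
    (l : ℝ) (hl : AnalyticSG.growthBound (fun t : ℝ => T (t : ℂ)) < (l : EReal)) :
    AnalyticSG.DomainEmbeds
      (AnalyticSG.fracPow (fun t : ℝ => T (t : ℂ)) l γ) K := by
  obtain ⟨w, hw, M', hb⟩ := AnalyticSG.exists_norm_le_of_growthBound_lt hl
  have hS := hT.isExpBoundedSemigroup hb
  obtain ⟨C, -, hC⟩ := hT.exists_norm_apply_le hA hAK hM hρ₀ hest hb
  obtain ⟨C', hC'⟩ := hS.exists_negFracPow_mem_graph hw hK hα0.le hγ hC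
  exact AnalyticSG.fracPow_domainEmbeds (hS.negFracPow_injective hw (hα0.trans hγ)) K C' hC'
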